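/- **Theorem (The Ghost Lemma).** Let $(\mathcal A;\mathcal E)$ be an exact category: an additive category $\mathcal A$ with a class $\mathcal E$ of kernel-cokernel pairs (conflations $A\to B\to C$, consisting of an inflation and a deflation), closed under isomorphism and satisfying Quillen's axioms. An ideal $\mathcal I$ of $\mathcal A$ is an additive subbifunctor of $\mathrm{Hom}$, and $\langle\mathcal M\rangle$ denotes the smallest ideal containing a class $\mathcal M$ of morphisms. Use the following notions. * An ME-conflation $i\to a\to j$ of morphisms $i:I_0\to I_1$, $a:A_0\to A_1$, $j:J_0\to J_1$ is a morphism $(i,a,j)$ from a conflation $I_0\to A_0\xrightarrow{e_0}J_0$ to a conflation $I_1\xrightarrow{m_1}A_1\to J_1$ which factors through some conflation $I_0\to B\to J_1$ as $(i,a_2,1_{J_1})\circ(1_{I_0},a_1,j)$, with $a=a_2a_1$. It is null-homotopic if $a=m_1h+ge_0$ for some $h:A_0\to I_1$ and $g:J_0\to A_1$. * $\mathcal I\mathcal J=\langle ij \mid i\in\mathcal I,\ j\in\mathcal J \text{ composable}\rangle$ (first $j$, then $i$), and $\mathcal I\diamond\mathcal J=\langle a \mid \text{there is an ME-conflation } i\to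 a\to j \text{ with } i\in\mathcal I,\ j\in\mathcal J\rangle$. * $\mathrm{Ext}(j,i)=0$ means that every ME-conflation $i\to a\to j$ is null-homotopic; $\mathcal I^\perp=\{k\mid \mathrm{Ext}(i,k)=0\ \forall i\in\mathcal I\}$ and ${}^\perp\mathcal J=\{k\mid \mathrm{Ext}(k,j)=0\ \forall j\in\mathcal J\}$. These are ideals. * A special $\mathcal I$-precover of an object $X$ is a morphism $i_1:C_1\to X$ in $\mathcal I$ that is the deflation of a conflation $K_1\to C_1\to X$ obtained from some conflation $K_0\to C_0\to X$ by pushout along a morphism $k:K_0\to K_1$ in $\mathcal I^\perp$. Dually, a special $\mathcal J$-preenvelope of $X$ is a morphism $j_1:X\to C_1$ in $\mathcal J$ that is the inflation of a conflation $X\to C_1\to K_1$ obtained from some conflation $X\to C_0\to K_0$ by pullback along a morphism $k:K_1\to K_0$ in ${}^\perp\mathcal J$. The ideal $\mathcal I$ is special precovering (resp. special preenveloping) if every object has a special $\mathcal I$-precover (resp. special $\mathcal I$-preenvelope). * A morphism is injective (resp. projective) if it belongs to $\mathrm{Hom}^\perp$ (resp. ${}^\perp\mathrm{Hom}$), where $\mathrm{Hom}$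 is the ideal of all morphisms. Assume that $(\mathcal A;\mathcal E)$ has enough injective morphisms (every object $X$ admits an inflation $X\to Y$ that is an injective morphism) and enough projective morphisms (every object $X$ admits a deflation $Y\to X$ that is a projective morphism). Then: 1. if $\mathcal I$ and $\mathcal J$ are special precovering ideals, so are $\mathcal I\mathcal J$ and $\mathcal I\diamond\mathcal J$; 2. if $\mathcal I$ and $\mathcal J$ are special preenveloping ideals, so are $\mathcal I\mathcal J$ and $\mathcal I\diamond\mathcal J$; 3. the rule $\mathcal I\mapsto\mathcal I^\perp$ is a bijective correspondence from the class of special precovering ideals onto the class of special preenveloping ideals, and for all special precovering ideals $\mathcal I,\mathcal J$, $$(\mathcal I\mathcal J)^\perp=\mathcal J^\perp\diamond\mathcal I^\perp\qquad\text{and}\qquad(\mathcal I\diamond\mathcal J)^\perp=\mathcal J^\perp\mathcal I^\perp.$$ -/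

import Mathlib

open CategoryTheory CategoryTheory.Limits

universe v u

/-- An ideal of a preadditive category: an additive subbifunctor of `Hom`. -/
@[ext]
structure MorphismIdeal (A : Type u) [Category.{v} A] [Preadditive A] where
  /-- The subgroup of `Hom (X, Y)` formed by the morphisms `X ⟶ Y` of the ideal. -/
  hom : ∀ X Y : A, AddSubgroup (X ⟶ Y)
  precomp_mem : ∀ {X' X Y : A} (s : X' ⟶ X) {f : X ⟶ Y}, f ∈ hom X Y → s ≫ f ∈ hom X' Y
  postcomp_mem : ∀ {X Y Y' : A} {f : X ⟶ Y} (r : Y ⟶ Y'), f ∈ hom X Y → f ≫ r ∈ hom X Y'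

namespace MorphismIdeal

variable {A : Type u} [Category.{v} A] [Preadditive A]

/-- The class of all morphisms that belong to an ideal. -/
def toProperty (I : MorphismIdeal A) : MorphismProperty A :=
  fun X Y f => f ∈ I.hom X Y

/-- The ideal `Hom` of all morphisms. -/
def homIdeal (A : Type u) [Category.{v} A] [Preadditive A] : MorphismIdeal A where
  hom _ _ := ⊤
  precomp_mem _ _ _ := AddSubgroup.mem_top _
  postcomp_mem _ _ := AddSubgroup.mem_top _

/-- The smallest ideal `⟨M⟩` that contains a class `M` of morphisms: the intersection of all
the ideals that contain it. -/
def span (M : MorphismProperty A) : MorphismIdeal A where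
  hom X Y := ⨅ (I : MorphismIdeal A) (_ : M ≤ I.toProperty), I.hom X Y
  precomp_mem s f hf := by
    simp only [AddSubgroup.mem_iInf] at hf ⊢
    exact fun I hI => I.precomp_mem s (hf I hI)
  postcomp_mem r hf := by
    simp only [AddSubgroup.mem_iInf] at hf ⊢
    exact fun I hI => I.postcomp_mem r (hf I hI)

/-- The product `I J`, generated by the composites `i ∘ j` (first `j`, then `i`) with `i ∈ I`
and `j ∈ J`. -/
instance : Mul (MorphismIdeal A) where
  mul I J := span fun X Z f =>
    ∃ (Y : A) (j : X ⟶ Y) (i : Y ⟶ Z), j ∈ J.hom X Y ∧ i ∈ I.hom Y Z ∧ j ≫ i = f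

end MorphismIdeal

/-- The two maps of `S` form a kernel-cokernel pair. -/
structure IsKernelCokernelPair {A : Type u} [Category.{v} A] [Preadditive A]
    (S : ShortComplex A) : Prop where
  isKernel : Nonempty (IsLimit (KernelFork.ofι S.f S.zero))
  isCokernel : Nonempty (IsColimit (CokernelCofork.ofπ S.g S.zero))

/-- `m` is the first map of a short complex in the class `P`. -/
def IsInflationOf {A : Type u} [Category.{v} A] [Preadditive A]
    (P : ShortComplex A → Prop) {X Y : A} (m : X ⟶ Y) : Prop :=
  ∃ (Z : A) (e : Y ⟶ Z) (w : m ≫ e = 0), P (ShortComplex.mk m e w)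

/-- `e` is the second map of a short complex in the class `P`. -/
def IsDeflationOf {A : Type u} [Category.{v} A] [Preadditive A]
    (P : ShortComplex A → Prop) {Y Z : A} (e : Y ⟶ Z) : Prop :=
  ∃ (X : A) (m : X ⟶ Y) (w : m ≫ e = 0), P (ShortComplex.mk m e w)

/-- An exact structure (in the sense of Quillen) on a category: a class of kernel-cokernel pairs,
called conflations, closed under isomorphism and subject to the axioms
E₀, E₀ᵒᵖ, E₁, E₁ᵒᵖ, E₂, E₂ᵒᵖ. -/
structure ExactStructure (A : Type u) [Category.{v} A] [Preadditive A] where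
  Conflation : ShortComplex A → Prop
  isKernelCokernelPair : ∀ {S : ShortComplex A}, Conflation S → IsKernelCokernelPair S
  of_iso : ∀ {S T : ShortComplex A}, (S ≅ T) → Conflation S → Conflation T
  inflation_id : ∀ X : A, IsInflationOf Conflation (𝟙 X)
  deflation_id : ∀ X : A, IsDeflationOf Conflation (𝟙 X)
  inflation_comp : ∀ {X Y Z : A} (m : X ⟶ Y) (n : Y ⟶ Z),
    IsInflationOf Conflation m → IsInflationOf Conflation n → IsInflationOf Conflation (m ≫ n)
  deflation_comp : ∀ {X Y Z : A} (d : X ⟶ Y) (e : Y ⟶ Z),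
    IsDeflationOf Conflation d → IsDeflationOf Conflation e → IsDeflationOf Conflation (d ≫ e)
  inflation_pushout : ∀ {X Y X' : A} (m : X ⟶ Y) (s : X ⟶ X'), IsInflationOf Conflation m →
    ∃ (Y' : A) (c : Y ⟶ Y') (m' : X' ⟶ Y'), IsPushout m s c m' ∧ IsInflationOf Conflation m'
  deflation_pullback : ∀ {Y Z Z' : A} (e : Y ⟶ Z) (t : Z' ⟶ Z), IsDeflationOf Conflation e →
    ∃ (Y' : A) (e' : Y' ⟶ Z') (c : Y' ⟶ Y), IsPullback e' c t e ∧ IsDeflationOf Conflation e'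

namespace ExactStructure

variable {A : Type u} [Category.{v} A] [Preadditive A] (E : ExactStructure A)

def IsInflation {X Y : A} (m : X ⟶ Y) : Prop := IsInflationOf E.Conflation m

def IsDeflation {Y Z : A} (e : Y ⟶ Z) : Prop := IsDeflationOf E.Conflation e

/-- A mono-epi (ME) conflation `i → a → j` of arrows: a morphism of conflations
```
  I₀ --m₀--> A₀ --e₀--> J₀
  |          |a₁        |j
  I₀ --m---> B  --e---> J₁
  |i         |a₂        |
  I₁ --m₁--> A₁ --e₁--> J₁
```
from the top row to the bottom row, with middle component `a = a₂ ∘ a₁`, that factors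
through a conflation (the middle row) as displayed. -/
structure MEConflation {I₀ I₁ A₀ A₁ J₀ J₁ : A} (i : I₀ ⟶ I₁) (a : A₀ ⟶ A₁) (j : J₀ ⟶ J₁) where
  m₀ : I₀ ⟶ A₀
  e₀ : A₀ ⟶ J₀
  m₁ : I₁ ⟶ A₁
  e₁ : A₁ ⟶ J₁
  B : A
  m : I₀ ⟶ B
  e : B ⟶ J₁
  a₁ : A₀ ⟶ B
  a₂ : B ⟶ A₁
  zero₀ : m₀ ≫ e₀ = 0
  zero₁ : m₁ ≫ e₁ = 0
  zero : m ≫ e = 0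
  conflation₀ : E.Conflation (ShortComplex.mk m₀ e₀ zero₀)
  conflation₁ : E.Conflation (ShortComplex.mk m₁ e₁ zero₁)
  conflation : E.Conflation (ShortComplex.mk m e zero)
  m₀_a₁ : m₀ ≫ a₁ = m
  a₁_e : a₁ ≫ e = e₀ ≫ j
  m_a₂ : m ≫ a₂ = i ≫ m₁
  a₂_e₁ : a₂ ≫ e₁ = e
  a₁_a₂ : a₁ ≫ a₂ = a

/-- The class `M ⋆ N` of the arrows `a` that are extensions of `j` by `i`, that is, the middle
term of an ME-conflation `i → a → j`, with `i ∈ M` and `j ∈ N`. -/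
def star (M N : MorphismProperty A) : MorphismProperty A := fun _ _ a =>
  ∃ (I₀ I₁ J₀ J₁ : A) (i : I₀ ⟶ I₁) (j : J₀ ⟶ J₁),
    M i ∧ N j ∧ Nonempty (E.MEConflation i a j)

/-- The extension ideal `I ◇ J = ⟨I ⋆ J⟩` of `J` by `I`. -/
def extIdeal (I J : MorphismIdeal A) : MorphismIdeal A :=
  MorphismIdeal.span (E.star I.toProperty J.toProperty)

/-- `Ext(j, i) = 0`: every ME-conflation `i → a → j` is null-homotopic. -/
def ExtOrthogonal {J₀ J₁ I₀ I₁ : A} (j : J₀ ⟶ J₁) (i : I₀ ⟶ I₁) : Prop :=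
  ∀ (A₀ A₁ : A) (a : A₀ ⟶ A₁) (ξ : E.MEConflation i a j),
    ∃ (h : A₀ ⟶ I₁) (g : J₀ ⟶ A₁), a = h ≫ ξ.m₁ + ξ.e₀ ≫ g

/-! Helper facts: the Ext-perpendicular classes of an ideal are ideals. -/

section helpers

variable {E}

lemma Conflation.mono {X Y Z : A} {m : X ⟶ Y} {e : Y ⟶ Z} {w : m ≫ e = 0}
    (h : E.Conflation (ShortComplex.mk m e w)) : Mono m := by
  obtain ⟨l⟩ := (E.isKernelCokernelPair h).isKernel
  exact mono_of_isLimit_fork l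

lemma Conflation.epi {X Y Z : A} {m : X ⟶ Y} {e : Y ⟶ Z} {w : m ≫ e = 0}
    (h : E.Conflation (ShortComplex.mk m e w)) : Epi e := by
  obtain ⟨l⟩ := (E.isKernelCokernelPair h).isCokernel
  exact epi_of_isColimit_cofork l

lemma Conflation.exists_desc {X Y Z : A} {m : X ⟶ Y} {e : Y ⟶ Z} {w : m ≫ e = 0}
    (h : E.Conflation (ShortComplex.mk m e w)) {T : A} (t : Y ⟶ T) (ht : m ≫ t = 0) :
    ∃ u : Z ⟶ T, e ≫ u = t := by
  obtain ⟨l⟩ := (E.isKernelCokernelPair h).isCokernel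
  obtain ⟨u, hu⟩ := CokernelCofork.IsColimit.desc' l t ht
  exact ⟨u, hu⟩

lemma Conflation.exists_lift {X Y Z : A} {m : X ⟶ Y} {e : Y ⟶ Z} {w : m ≫ e = 0}
    (h : E.Conflation (ShortComplex.mk m e w)) {T : A} (t : T ⟶ Y) (ht : t ≫ e = 0) :
    ∃ u : T ⟶ X, u ≫ m = t := by
  obtain ⟨l⟩ := (E.isKernelCokernelPair h).isKernel
  obtain ⟨u, hu⟩ := KernelFork.IsLimit.lift' l t ht
  exact ⟨u, hu⟩

/-- The pushout of a conflation along a morphism from its left term. -/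
lemma Conflation.exists_pushout {X Y Z X' : A} {m : X ⟶ Y} {e : Y ⟶ Z} {w : m ≫ e = 0}
    (h : E.Conflation (ShortComplex.mk m e w)) (s : X ⟶ X') :
    ∃ (Y' : A) (c : Y ⟶ Y') (m' : X' ⟶ Y') (e' : Y' ⟶ Z) (w' : m' ≫ e' = 0),
      IsPushout m s c m' ∧ c ≫ e' = e ∧ E.Conflation (ShortComplex.mk m' e' w') := by
  obtain ⟨Y', c, m', hp, Q, q, wq, hq⟩ := E.inflation_pushout m s ⟨Z, e, w, h⟩
  have hw : m ≫ e = s ≫ (0 : X' ⟶ Z) := by simp [w]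
  have h1 : c ≫ hp.desc e 0 hw = e := hp.inl_desc _ _ _
  have h2 : m' ≫ hp.desc e 0 hw = 0 := hp.inr_desc _ _ _
  generalize hp.desc e 0 hw = e' at h1 h2
  have := Conflation.epi h
  have := Conflation.epi hq
  obtain ⟨u, hu⟩ := Conflation.exists_desc hq e' h2
  obtain ⟨t, ht⟩ := Conflation.exists_desc h (c ≫ q) (by
    rw [← Category.assoc, hp.w, Category.assoc, wq, comp_zero])
  have he't : e' ≫ t = q := hp.hom_ext (by rw [← Category.assoc, h1, ht])
    (by rw [← Category.assoc, h2, wq, zero_comp])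
  let φ : Q ≅ Z :=
    { hom := u
      inv := t
      hom_inv_id := by rw [← cancel_epi q, ← Category.assoc, hu, he't, Category.comp_id]
      inv_hom_id := by
        rw [← cancel_epi e, ← Category.assoc, ht, Category.assoc, hu, h1, Category.comp_id] }
  exact ⟨Y', c, m', e', h2, hp, h1, E.of_iso (S := ShortComplex.mk m' q wq)
    (ShortComplex.isoMk (Iso.refl _) (Iso.refl _) φ (by simp) (by simp [φ, hu])) hq⟩

/-- The pullback of a conflation along a morphism to its right term. -/
lemma Conflation.exists_pullback {X Y Z Z' : A} {m : X ⟶ Y} {e : Y ⟶ Z} {w : m ≫ e = 0}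
    (h : E.Conflation (ShortComplex.mk m e w)) (t : Z' ⟶ Z) :
    ∃ (Y' : A) (m' : X ⟶ Y') (e' : Y' ⟶ Z') (c : Y' ⟶ Y) (w' : m' ≫ e' = 0),
      IsPullback e' c t e ∧ m' ≫ c = m ∧ E.Conflation (ShortComplex.mk m' e' w') := by
  obtain ⟨Y', e', c, hp, K, k, wk, hk⟩ := E.deflation_pullback e t ⟨X, m, w, h⟩
  have hw : (0 : X ⟶ Z') ≫ t = m ≫ e := by simp [w]
  have h1 : hp.lift 0 m hw ≫ c = m := hp.lift_snd _ _ _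
  have h2 : hp.lift 0 m hw ≫ e' = 0 := hp.lift_fst _ _ _
  generalize hp.lift 0 m hw = m' at h1 h2
  have := Conflation.mono h
  have := Conflation.mono hk
  obtain ⟨a, ha⟩ := Conflation.exists_lift hk m' h2
  obtain ⟨b, hb⟩ := Conflation.exists_lift h (k ≫ c) (by
    rw [Category.assoc, ← hp.w, ← Category.assoc, wk, zero_comp])
  have hbm : b ≫ m' = k := hp.hom_ext (by rw [Category.assoc, h2, wk, comp_zero])
    (by rw [Category.assoc, h1, hb])
  let φ : K ≅ X :=
    { hom := b
      inv := a
      hom_inv_id := by rw [← cancel_mono k, Category.assoc, ha, hbm, Category.id_comp]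
      inv_hom_id := by
        rw [← cancel_mono m, Category.assoc, hb, ← Category.assoc, ha, h1, Category.id_comp] }
  exact ⟨Y', m', e', c, h2, hp, h1, E.of_iso (S := ShortComplex.mk k e' wk)
    (ShortComplex.isoMk φ (Iso.refl _) (Iso.refl _) (by simp [φ, hbm]) (by simp)) hk⟩

lemma extOrthogonal_iff_factor_left {J₀ J₁ I₀ I₁ : A} (j : J₀ ⟶ J₁) (i : I₀ ⟶ I₁) :
    E.ExtOrthogonal j i ↔ ∀ (A₀ B : A) (m₀ : I₀ ⟶ A₀) (e₀ : A₀ ⟶ J₀) (m : I₀ ⟶ B) (e : B ⟶ J₁)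
      (w₀ : m₀ ≫ e₀ = 0) (w : m ≫ e = 0) (a₁ : A₀ ⟶ B),
      E.Conflation (ShortComplex.mk m₀ e₀ w₀) → E.Conflation (ShortComplex.mk m e w) →
      m₀ ≫ a₁ = m → a₁ ≫ e = e₀ ≫ j → ∃ h : A₀ ⟶ I₁, m₀ ≫ h = i := by
  constructor
  · intro H A₀ B m₀ e₀ m e w₀ w a₁ h₀ h hm he
    obtain ⟨A₁, a₂, m₁, e₁, w₁, hp, hc, h₁⟩ := Conflation.exists_pushout h i
    obtain ⟨k, g, hkg⟩ := H A₀ A₁ (a₁ ≫ a₂)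
      ⟨m₀, e₀, m₁, e₁, B, m, e, a₁, a₂, w₀, w₁, w, h₀, h₁, h, hm, he, hp.w, hc, rfl⟩
    refine ⟨k, ?_⟩
    have := Conflation.mono h₁
    have hx := congrArg (fun x => m₀ ≫ x) hkg
    simp only [Preadditive.comp_add] at hx
    rw [← Category.assoc, hm, hp.w, ← Category.assoc m₀ e₀, w₀, zero_comp, add_zero,
      ← Category.assoc] at hx
    exact ((cancel_mono m₁).1 hx).symm
  · intro H A₀ A₁ a ξ
    obtain ⟨k, hk⟩ := H _ _ _ _ _ _ ξ.zero₀ ξ.zero ξ.a₁ ξ.conflation₀ ξ.conflation ξ.m₀_a₁ ξ.a₁_e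
    have hx : ξ.m₀ ≫ a = i ≫ ξ.m₁ := (congrArg (fun x => ξ.m₀ ≫ x) ξ.a₁_a₂).symm.trans (by
      rw [← Category.assoc, ξ.m₀_a₁, ξ.m_a₂])
    obtain ⟨g, hg⟩ := Conflation.exists_desc ξ.conflation₀ (a - k ≫ ξ.m₁) (by
      rw [Preadditive.comp_sub, hx, ← Category.assoc, hk, sub_self])
    exact ⟨k, g, by rw [hg]; abel⟩

lemma extOrthogonal_iff_factor_right {J₀ J₁ I₀ I₁ : A} (j : J₀ ⟶ J₁) (i : I₀ ⟶ I₁) :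
    E.ExtOrthogonal j i ↔ ∀ (A₁ B : A) (m₁ : I₁ ⟶ A₁) (e₁ : A₁ ⟶ J₁) (m : I₀ ⟶ B) (e : B ⟶ J₁)
      (w₁ : m₁ ≫ e₁ = 0) (w : m ≫ e = 0) (a₂ : B ⟶ A₁),
      E.Conflation (ShortComplex.mk m₁ e₁ w₁) → E.Conflation (ShortComplex.mk m e w) →
      m ≫ a₂ = i ≫ m₁ → a₂ ≫ e₁ = e → ∃ g : J₀ ⟶ A₁, g ≫ e₁ = j := by
  constructor
  · intro H A₁ B m₁ e₁ m e w₁ w a₂ h₁ h hm he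
    obtain ⟨A₀, m₀, e₀, a₁, w₀, hp, hc, h₀⟩ := Conflation.exists_pullback h j
    obtain ⟨k, g, hkg⟩ := H A₀ A₁ (a₁ ≫ a₂)
      ⟨m₀, e₀, m₁, e₁, B, m, e, a₁, a₂, w₀, w₁, w, h₀, h₁, h, hc, hp.w.symm, hm, he, rfl⟩
    refine ⟨g, ?_⟩
    have := Conflation.epi h₀
    have hx := congrArg (fun x => x ≫ e₁) hkg
    simp only [Preadditive.add_comp] at hx
    rw [Category.assoc, he, ← hp.w, Category.assoc k, w₁, comp_zero, zero_add,
      Category.assoc] at hx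
    exact ((cancel_epi e₀).1 hx).symm
  · intro H A₀ A₁ a ξ
    obtain ⟨g, hg⟩ := H _ _ _ _ _ _ ξ.zero₁ ξ.zero ξ.a₂ ξ.conflation₁ ξ.conflation ξ.m_a₂ ξ.a₂_e₁
    have hx : a ≫ ξ.e₁ = ξ.e₀ ≫ j := (congrArg (fun x => x ≫ ξ.e₁) ξ.a₁_a₂).symm.trans (by
      rw [Category.assoc, ξ.a₂_e₁, ξ.a₁_e])
    obtain ⟨k, hk⟩ := Conflation.exists_lift ξ.conflation₁ (a - ξ.e₀ ≫ g) (by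
      rw [Preadditive.sub_comp, hx, Category.assoc, hg, sub_self])
    exact ⟨k, g, by rw [hk]; abel⟩

lemma ExtOrthogonal.precomp_right {J₀ J₁ I I₀ I₁ : A} {j : J₀ ⟶ J₁} {i : I₀ ⟶ I₁}
    (H : E.ExtOrthogonal j i) (s : I ⟶ I₀) : E.ExtOrthogonal j (s ≫ i) := by
  rw [extOrthogonal_iff_factor_left] at H ⊢
  intro A₀ B m₀ e₀ m e w₀ w a₁ h₀ h hm he
  obtain ⟨A₀', c₀, m₀', e₀', w₀', hp₀, hc₀, h₀'⟩ := Conflation.exists_pushout h₀ s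
  obtain ⟨B', c, m', e', w', hp, hc, h'⟩ := Conflation.exists_pushout h s
  have hw : m₀ ≫ a₁ ≫ c = s ≫ m' := by rw [← Category.assoc, hm, hp.w]
  obtain ⟨k, hk⟩ := H A₀' B' m₀' e₀' m' e' w₀' w' (hp₀.desc (a₁ ≫ c) m' hw) h₀' h'
    (hp₀.inr_desc _ _ _) (hp₀.hom_ext
      (by rw [← Category.assoc, hp₀.inl_desc, Category.assoc, hc, he, ← Category.assoc, hc₀])
      (by rw [← Category.assoc, hp₀.inr_desc, w', ← Category.assoc, w₀', zero_comp]))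
  exact ⟨c₀ ≫ k, by rw [← Category.assoc, hp₀.w, Category.assoc, hk]⟩

lemma ExtOrthogonal.postcomp_left {J₀ J₁ J I₀ I₁ : A} {j : J₀ ⟶ J₁} {i : I₀ ⟶ I₁}
    (H : E.ExtOrthogonal j i) (r : J₁ ⟶ J) : E.ExtOrthogonal (j ≫ r) i := by
  rw [extOrthogonal_iff_factor_right] at H ⊢
  intro A₁ B m₁ e₁ m e w₁ w a₂ h₁ h hm he
  obtain ⟨A₁', m₁', e₁', c₁, w₁', hp₁, hc₁, h₁'⟩ := Conflation.exists_pullback h₁ r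
  obtain ⟨B', m', e', c, w', hp, hc, h'⟩ := Conflation.exists_pullback h r
  have hw : e' ≫ r = (c ≫ a₂) ≫ e₁ := by rw [Category.assoc, he, hp.w]
  obtain ⟨k, hk⟩ := H A₁' B' m₁' e₁' m' e' w₁' w' (hp₁.lift e' (c ≫ a₂) hw) h₁' h'
    (hp₁.hom_ext
      (by rw [Category.assoc, hp₁.lift_fst, w', Category.assoc, w₁', comp_zero])
      (by rw [Category.assoc, hp₁.lift_snd, ← Category.assoc, hc, hm, Category.assoc, hc₁]))
    (hp₁.lift_fst _ _ _)
  exact ⟨k ≫ c₁, by rw [Category.assoc, ← hp₁.w, ← Category.assoc, hk]⟩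

end helpers

/-- The right Ext-perpendicular ideal `I^⊥ = {j | Ext(i, j) = 0 for all i ∈ I}`. -/
def rightPerp (I : MorphismIdeal A) : MorphismIdeal A where
  hom X Y :=
    { carrier := {j | ∀ (X' Y' : A) (i : X' ⟶ Y'), i ∈ I.hom X' Y' → E.ExtOrthogonal i j}
      zero_mem' := fun X' Y' i _ => by
        rw [extOrthogonal_iff_factor_left]
        intros
        exact ⟨0, comp_zero⟩
      add_mem' := fun {a b} ha hb X' Y' i hi => by
        have ha' := ha X' Y' i hi
        have hb' := hb X' Y' i hi
        rw [extOrthogonal_iff_factor_left] at ha' hb' ⊢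
        intro A₀ B m₀ e₀ m e w₀ w a₁ h₀ h hm he
        obtain ⟨k, hk⟩ := ha' A₀ B m₀ e₀ m e w₀ w a₁ h₀ h hm he
        obtain ⟨l, hl⟩ := hb' A₀ B m₀ e₀ m e w₀ w a₁ h₀ h hm he
        exact ⟨k + l, by rw [Preadditive.comp_add, hk, hl]⟩
      neg_mem' := fun {a} ha X' Y' i hi => by
        have ha' := ha X' Y' i hi
        rw [extOrthogonal_iff_factor_left] at ha' ⊢
        intro A₀ B m₀ e₀ m e w₀ w a₁ h₀ h hm he
        obtain ⟨k, hk⟩ := ha' A₀ B m₀ e₀ m e w₀ w a₁ h₀ h hm he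
        exact ⟨-k, by rw [Preadditive.comp_neg, hk]⟩ }
  precomp_mem s _ hf X' Y' i hi := (hf X' Y' i hi).precomp_right s
  postcomp_mem r hf X' Y' i hi := by
    have hf' := hf X' Y' i hi
    rw [extOrthogonal_iff_factor_left] at hf' ⊢
    intro A₀ B m₀ e₀ m e w₀ w a₁ h₀ h hm he
    obtain ⟨k, hk⟩ := hf' A₀ B m₀ e₀ m e w₀ w a₁ h₀ h hm he
    exact ⟨k ≫ r, by rw [← Category.assoc, hk]⟩

/-- The left Ext-perpendicular ideal `^⊥J = {i | Ext(i, j) = 0 for all j ∈ J}`. -/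
def leftPerp (J : MorphismIdeal A) : MorphismIdeal A where
  hom X Y :=
    { carrier := {i | ∀ (X' Y' : A) (j : X' ⟶ Y'), j ∈ J.hom X' Y' → E.ExtOrthogonal i j}
      zero_mem' := fun X' Y' j _ => by
        rw [extOrthogonal_iff_factor_right]
        intros
        exact ⟨0, zero_comp⟩
      add_mem' := fun {a b} ha hb X' Y' j hj => by
        have ha' := ha X' Y' j hj
        have hb' := hb X' Y' j hj
        rw [extOrthogonal_iff_factor_right] at ha' hb' ⊢
        intro A₁ B m₁ e₁ m e w₁ w a₂ h₁ h hm he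
        obtain ⟨k, hk⟩ := ha' A₁ B m₁ e₁ m e w₁ w a₂ h₁ h hm he
        obtain ⟨l, hl⟩ := hb' A₁ B m₁ e₁ m e w₁ w a₂ h₁ h hm he
        exact ⟨k + l, by rw [Preadditive.add_comp, hk, hl]⟩
      neg_mem' := fun {a} ha X' Y' j hj => by
        have ha' := ha X' Y' j hj
        rw [extOrthogonal_iff_factor_right] at ha' ⊢
        intro A₁ B m₁ e₁ m e w₁ w a₂ h₁ h hm he
        obtain ⟨k, hk⟩ := ha' A₁ B m₁ e₁ m e w₁ w a₂ h₁ h hm he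
        exact ⟨-k, by rw [Preadditive.neg_comp, hk]⟩ }
  precomp_mem s _ hf X' Y' j hj := by
    have hf' := hf X' Y' j hj
    rw [extOrthogonal_iff_factor_right] at hf' ⊢
    intro A₁ B m₁ e₁ m e w₁ w a₂ h₁ h hm he
    obtain ⟨k, hk⟩ := hf' A₁ B m₁ e₁ m e w₁ w a₂ h₁ h hm he
    exact ⟨s ≫ k, by rw [Category.assoc, hk]⟩
  postcomp_mem r hf X' Y' j hj := (hf X' Y' j hj).postcomp_left r

/-- `f` is an injective morphism: it lies in `Hom^⊥`. -/
def IsInjectiveMorphism {X Y : A} (f : X ⟶ Y) : Prop :=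
  f ∈ (E.rightPerp (MorphismIdeal.homIdeal A)).hom X Y

/-- `f` is a projective morphism: it lies in `^⊥Hom`. -/
def IsProjectiveMorphism {X Y : A} (f : X ⟶ Y) : Prop :=
  f ∈ (E.leftPerp (MorphismIdeal.homIdeal A)).hom X Y

/-- Every object is the domain of an injective inflation. -/
def HasEnoughInjectiveMorphisms : Prop :=
  ∀ X : A, ∃ (Y : A) (e : X ⟶ Y), E.IsInflation e ∧ E.IsInjectiveMorphism e

/-- Every object is the codomain of a projective deflation. -/
def HasEnoughProjectiveMorphisms : Prop :=
  ∀ X : A, ∃ (Y : A) (p : Y ⟶ X), E.IsDeflation p ∧ E.IsProjectiveMorphism p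

/-- `i₁ : C₁ ⟶ X` is a special `I`-precover of `X`: it lies in `I` and is the deflation of the
pushout `K₁ → C₁ → X` of some conflation `K₀ → C₀ → X` along a morphism `k : K₀ ⟶ K₁` in `I^⊥`. -/
def IsSpecialPrecover (I : MorphismIdeal A) {C₁ X : A} (i₁ : C₁ ⟶ X) : Prop :=
  i₁ ∈ I.hom C₁ X ∧
  ∃ (K₀ K₁ C₀ : A) (k : K₀ ⟶ K₁) (c : C₀ ⟶ C₁) (m₀ : K₀ ⟶ C₀) (i₀ : C₀ ⟶ X) (m₁ : K₁ ⟶ C₁)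
    (w₀ : m₀ ≫ i₀ = 0) (w₁ : m₁ ≫ i₁ = 0),
    E.Conflation (ShortComplex.mk m₀ i₀ w₀) ∧ E.Conflation (ShortComplex.mk m₁ i₁ w₁) ∧
    IsPushout m₀ k c m₁ ∧ c ≫ i₁ = i₀ ∧ k ∈ (E.rightPerp I).hom K₀ K₁

/-- `j₁ : X ⟶ C₁` is a special `J`-preenvelope of `X`: it lies in `J` and is the inflation of the
pullback `X → C₁ → K₁` of some conflation `X → C₀ → K₀` along a morphism `k : K₁ ⟶ K₀` in
`^⊥J`. -/
def IsSpecialPreenvelope (J : MorphismIdeal A) {X C₁ : A} (j₁ : X ⟶ C₁) : Prop :=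
  j₁ ∈ J.hom X C₁ ∧
  ∃ (K₀ K₁ C₀ : A) (k : K₁ ⟶ K₀) (c : C₁ ⟶ C₀) (j₀ : X ⟶ C₀) (e₀ : C₀ ⟶ K₀) (e₁ : C₁ ⟶ K₁)
    (w₀ : j₀ ≫ e₀ = 0) (w₁ : j₁ ≫ e₁ = 0),
    E.Conflation (ShortComplex.mk j₀ e₀ w₀) ∧ E.Conflation (ShortComplex.mk j₁ e₁ w₁) ∧
    IsPullback e₁ c k e₀ ∧ j₁ ≫ c = j₀ ∧ k ∈ (E.leftPerp J).hom K₁ K₀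

/-- Every object has a special `I`-precover. -/
def IsSpecialPrecovering (I : MorphismIdeal A) : Prop :=
  ∀ X : A, ∃ (C : A) (i : C ⟶ X), E.IsSpecialPrecover I i

/-- Every object has a special `J`-preenvelope. -/
def IsSpecialPreenveloping (J : MorphismIdeal A) : Prop :=
  ∀ X : A, ∃ (C : A) (j : X ⟶ C), E.IsSpecialPreenvelope J j

end ExactStructure

/-! The condition `Ext(j, i) = 0` says that pulling an extension of `J₁` by `I₀` back along `j` and
pushing it out along `i` splits it. The Ghost Lemma is then a two-step diagram chase. Let `a` pass
through the middle term of a conflation `L → Q → P`. If a first morphism kills the image of an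
extension class in `P`, exactness at `Q` brings the class from `L`, and a second morphism kills it
there. This is `ExtOrthogonal.comp_left`, with dual `ExtOrthogonal.comp_right`; it gives the
inclusions of `J^⊥ ◇ I^⊥` in `(I J)^⊥` and of `^⊥L ◇ ^⊥K` in `^⊥(K L)`. Conversely, Salce's Lemma
and special precovers yield an explicit conflation through which a given morphism of `(I J)^⊥`
factors (`mem_extIdeal_of_mem_rightPerp_mul`). Composing special precovers settles products, since
the induced map of kernels again passes through such a conflation. Special approximations also force
`^⊥(I^⊥) = I` and `(^⊥J)^⊥ = J`. With Salce's Lemma this gives the bijection and turns every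
statement about `◇` into one about products on the other side. -/

namespace MorphismIdeal

variable {A : Type u} [Category.{v} A] [Preadditive A]

/-! ### Ideals generated by a class of morphisms -/

lemma mem_span {M : MorphismProperty A} {X Y : A} {f : X ⟶ Y} (hf : M f) :
    f ∈ (span M).hom X Y := by
  simp only [span, AddSubgroup.mem_iInf]
  exact fun I hI => hI f hf

lemma span_le {M : MorphismProperty A} {I : MorphismIdeal A} (h : M ≤ I.toProperty) {X Y : A}
    {f : X ⟶ Y} (hf : f ∈ (span M).hom X Y) : f ∈ I.hom X Y := by
  simp only [span, AddSubgroup.mem_iInf] at hf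
  exact hf I h

lemma comp_mem_mul {I J : MorphismIdeal A} {X Y Z : A} {j : X ⟶ Y} {i : Y ⟶ Z}
    (hj : j ∈ J.hom X Y) (hi : i ∈ I.hom Y Z) : j ≫ i ∈ (I * J).hom X Z :=
  mem_span ⟨Y, j, i, hj, hi, rfl⟩

lemma ext_of_mem_iff {I J : MorphismIdeal A}
    (h : ∀ (X Y : A) (f : X ⟶ Y), f ∈ I.hom X Y ↔ f ∈ J.hom X Y) : I = J := by
  ext X Y f
  exact h X Y f

end MorphismIdeal

namespace ExactStructure

variable {A : Type u} [Category.{v} A] [Preadditive A] {E : ExactStructure A}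

/-! ### Conflations: composites and exactness of `Ext` -/

/-- A morphism that factors through the middle term `Q` of a conflation `L → Q → P`, such that
`L ⟶ Q ⟶ X'` lies in `I` and `X ⟶ Q ⟶ P` lies in `J`, belongs to `I ◇ J`. -/
lemma comp_mem_extIdeal {I J : MorphismIdeal A} {L Q P X X' : A} {m : L ⟶ Q} {e : Q ⟶ P}
    {w : m ≫ e = 0} (h : E.Conflation (ShortComplex.mk m e w)) {s : X ⟶ Q} {φ : Q ⟶ X'}
    (hφ : m ≫ φ ∈ I.hom L X') (hs : s ≫ e ∈ J.hom X P) : s ≫ φ ∈ (E.extIdeal I J).hom X X' := by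
  obtain ⟨T, m₀, e₀, a₁, w₀, hp₀, hm₀, h₀⟩ := Conflation.exists_pullback h (s ≫ e)
  obtain ⟨R, a₂, m₁, e₁, w₁, hp₁, he₁, h₁⟩ := Conflation.exists_pushout h (m ≫ φ)
  have key : a₁ ≫ a₂ ∈ (E.extIdeal I J).hom T R :=
    MorphismIdeal.mem_span ⟨_, _, _, _, m ≫ φ, s ≫ e, hφ, hs,
      ⟨⟨m₀, e₀, m₁, e₁, Q, m, e, a₁, a₂, w₀, w₁, w, h₀, h₁, h, hm₀, hp₀.w.symm, hp₁.w, he₁,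
        rfl⟩⟩⟩
  -- Both outer rows split: `s` provides a section of `e₀`, and `φ` a retraction of `m₁`. Between
  -- them, `a₁ ≫ a₂` restricts to `s ≫ φ`.
  have hl : 𝟙 X ≫ s ≫ e = s ≫ e := Category.id_comp _
  have hr : m ≫ φ = (m ≫ φ) ≫ 𝟙 X' := (Category.comp_id _).symm
  have := (E.extIdeal I J).postcomp_mem (hp₁.desc φ (𝟙 X') hr)
    ((E.extIdeal I J).precomp_mem (hp₀.lift (𝟙 X) s hl) key)
  rwa [← Category.assoc, hp₀.lift_snd, Category.assoc, hp₁.inl_desc] at this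

/-- The composite of two inflations, with the pushout of the second along the cokernel of the
first as its cokernel. -/
lemma Conflation.comp_of_isPushout {L B K R V : A} {m : L ⟶ B} {e : B ⟶ K} {w : m ≫ e = 0}
    (h : E.Conflation (ShortComplex.mk m e w)) {n : B ⟶ R} (hn : E.IsInflation n) {c : R ⟶ V}
    {n' : K ⟶ V} (hp : IsPushout n e c n') (wc : (m ≫ n) ≫ c = 0) :
    E.Conflation (ShortComplex.mk (m ≫ n) c wc) := by
  -- The axiom on composites only provides some cokernel `V'` of `m ≫ n`; the pushout `V` has the
  -- same universal property, so it is isomorphic to `V'`.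
  obtain ⟨V', d, wd, hd⟩ := E.inflation_comp m n ⟨K, e, w, h⟩ hn
  obtain ⟨u, hu⟩ := Conflation.exists_desc hd c wc
  obtain ⟨t, ht⟩ := Conflation.exists_desc h (n ≫ d) (by rw [← Category.assoc, wd])
  have := Conflation.epi hd
  have := Conflation.epi h
  have hcd : c ≫ hp.desc d t ht.symm = d := hp.inl_desc _ _ _
  have hnd : n' ≫ hp.desc d t ht.symm = t := hp.inr_desc _ _ _
  generalize hp.desc d t ht.symm = r at hcd hnd
  have htu : t ≫ u = n' := by
    rw [← cancel_epi e, ← Category.assoc, ht, Category.assoc, hu, hp.w]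
  let φ : V' ≅ V :=
    { hom := u
      inv := r
      hom_inv_id := by rw [← cancel_epi d, ← Category.assoc, hu, hcd, Category.comp_id]
      inv_hom_id := hp.hom_ext (by rw [← Category.assoc, hcd, hu, Category.comp_id])
        (by rw [← Category.assoc, hnd, htu, Category.comp_id]) }
  exact E.of_iso (S := ShortComplex.mk (m ≫ n) d wd)
    (ShortComplex.isoMk (Iso.refl _) (Iso.refl _) φ (by simp) (by simp [φ, hu])) hd

/-- The composite of two deflations, with the pullback of the first along the kernel of the
second as its kernel. -/
lemma Conflation.comp_of_isPullback {L Q P R V : A} {m : L ⟶ Q} {e : Q ⟶ P} {w : m ≫ e = 0}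
    (h : E.Conflation (ShortComplex.mk m e w)) {q : R ⟶ Q} (hq : E.IsDeflation q) {c : V ⟶ R}
    {q' : V ⟶ L} (hp : IsPullback q' c m q) (wc : c ≫ q ≫ e = 0) :
    E.Conflation (ShortComplex.mk c (q ≫ e) wc) := by
  obtain ⟨V', d, wd, hd⟩ := E.deflation_comp q e hq ⟨L, m, w, h⟩
  obtain ⟨u, hu⟩ := Conflation.exists_lift hd c wc
  obtain ⟨t, ht⟩ := Conflation.exists_lift h (d ≫ q) (by rw [Category.assoc, wd])
  have := Conflation.mono hd
  have := Conflation.mono h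
  have hcd : hp.lift t d ht ≫ c = d := hp.lift_snd _ _ _
  have hnd : hp.lift t d ht ≫ q' = t := hp.lift_fst _ _ _
  generalize hp.lift t d ht = r at hcd hnd
  have hut : u ≫ t = q' := by
    rw [← cancel_mono m, Category.assoc, ht, ← Category.assoc, hu, hp.w]
  let φ : V' ≅ V :=
    { hom := r
      inv := u
      hom_inv_id := by rw [← cancel_mono d, Category.assoc, hu, hcd, Category.id_comp]
      inv_hom_id := hp.hom_ext (by rw [Category.assoc, hnd, hut, Category.id_comp])
        (by rw [Category.assoc, hcd, hu, Category.id_comp]) }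
  exact E.of_iso (S := ShortComplex.mk d (q ≫ e) wd)
    (ShortComplex.isoMk φ (Iso.refl _) (Iso.refl _) (by simp [φ, hcd]) (by simp)) hd

/-- Exactness of `Ext(Y, L) → Ext(Y, B) → Ext(Y, K)`: an extension of `Y` by `B` whose pushout
along `B ⟶ K` splits comes from an extension of `Y` by `L`. -/
lemma Conflation.exists_of_pushout_split {L B K R Y : A} {m : L ⟶ B} {e : B ⟶ K} {w : m ≫ e = 0}
    (h : E.Conflation (ShortComplex.mk m e w)) {n : B ⟶ R} {q : R ⟶ Y} {wn : n ≫ q = 0}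
    (hn : E.Conflation (ShortComplex.mk n q wn)) (ρ : R ⟶ K) (hρ : n ≫ ρ = e) :
    ∃ (N : A) (m' : L ⟶ N) (e' : N ⟶ Y) (c : N ⟶ R) (w' : m' ≫ e' = 0),
      E.Conflation (ShortComplex.mk m' e' w') ∧ m' ≫ c = m ≫ n ∧ c ≫ q = e' := by
  obtain ⟨V, c₁, n', q', w', hp, hc, hn'⟩ := Conflation.exists_pushout hn e
  have he : n ≫ ρ = e ≫ 𝟙 K := by rw [hρ, Category.comp_id]
  have hr : n' ≫ hp.desc ρ (𝟙 K) he = 𝟙 K := hp.inr_desc _ _ _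
  generalize hp.desc ρ (𝟙 K) he = r at hr
  -- The pushed-out row `K → V → Y` has the retraction `r`; the complementary section `σ` of `q'` is
  -- the map along which `L → R → V` is pulled back.
  obtain ⟨σ, hσ⟩ := Conflation.exists_desc hn' (𝟙 V - r ≫ n') (by
    rw [Preadditive.comp_sub, ← Category.assoc, hr, Category.comp_id, Category.id_comp, sub_self])
  have := Conflation.epi hn'
  have hσq : σ ≫ q' = 𝟙 Y := by
    rw [← cancel_epi q', ← Category.assoc, hσ, Preadditive.sub_comp, Category.assoc, w',
      comp_zero, sub_zero, Category.id_comp, Category.comp_id]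
  have wc : (m ≫ n) ≫ c₁ = 0 := by
    rw [Category.assoc, hp.w, ← Category.assoc, w, zero_comp]
  obtain ⟨N, m', e', c, wN, hpN, hmN, hN⟩ := Conflation.exists_pullback
    (Conflation.comp_of_isPushout h ⟨Y, q, wn, hn⟩ hp wc) σ
  exact ⟨N, m', e', c, wN, hN, hmN, by
    rw [← hc, ← Category.assoc, ← hpN.w, Category.assoc, hσq, Category.comp_id]⟩

/-- Exactness of `Ext(P, K) → Ext(Q, K) → Ext(L, K)`: an extension of `Q` by `K` whose pullback
along `L ⟶ Q` splits comes from an extension of `P` by `K`. -/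
lemma Conflation.exists_of_pullback_split {L Q P R K : A} {m : L ⟶ Q} {e : Q ⟶ P} {w : m ≫ e = 0}
    (h : E.Conflation (ShortComplex.mk m e w)) {n : K ⟶ R} {q : R ⟶ Q} {wn : n ≫ q = 0}
    (hn : E.Conflation (ShortComplex.mk n q wn)) (ρ : L ⟶ R) (hρ : ρ ≫ q = m) :
    ∃ (N : A) (m' : K ⟶ N) (e' : N ⟶ P) (c : R ⟶ N) (w' : m' ≫ e' = 0),
      E.Conflation (ShortComplex.mk m' e' w') ∧ n ≫ c = m' ∧ c ≫ e' = q ≫ e := by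
  obtain ⟨V, n', q', c₁, w', hp, hc, hn'⟩ := Conflation.exists_pullback hn m
  have he : 𝟙 L ≫ m = ρ ≫ q := by rw [hρ, Category.id_comp]
  have hr : hp.lift (𝟙 L) ρ he ≫ q' = 𝟙 L := hp.lift_fst _ _ _
  generalize hp.lift (𝟙 L) ρ he = r at hr
  obtain ⟨σ, hσ⟩ := Conflation.exists_lift hn' (𝟙 V - q' ≫ r) (by
    rw [Preadditive.sub_comp, Category.assoc, hr, Category.comp_id, Category.id_comp, sub_self])
  have := Conflation.mono hn'
  have hσn : n' ≫ σ = 𝟙 K := by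
    rw [← cancel_mono n', Category.assoc, hσ, Preadditive.comp_sub, ← Category.assoc, w',
      zero_comp, sub_zero, Category.id_comp, Category.comp_id]
  have wc : c₁ ≫ q ≫ e = 0 := by
    rw [← Category.assoc, ← hp.w, Category.assoc, w, comp_zero]
  obtain ⟨N, c, m', e', wN, hpN, hmN, hN⟩ := Conflation.exists_pushout
    (Conflation.comp_of_isPullback h ⟨K, n, wn, hn⟩ hp wc) σ
  exact ⟨N, m', e', c, wN, hN, by
    rw [← hc, Category.assoc, hpN.w, ← Category.assoc, hσn, Category.id_comp], hmN⟩

/-! ### Orthogonality of a composite to a morphism through a conflation -/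

/-- This is the heart of the Ghost Lemma. Pull an extension back along `i` and push it out along
`s`. Its image in `P` splits, so it comes from an extension by `L`; pushing that one out along `m ≫
φ` and pulling it back along `j` splits it. -/
lemma ExtOrthogonal.comp_left {L Q P X X' X₀ Y Z : A} {m : L ⟶ Q} {e : Q ⟶ P} {w : m ≫ e = 0}
    (h : E.Conflation (ShortComplex.mk m e w)) {s : X ⟶ Q} {φ : Q ⟶ X'} {j : X₀ ⟶ Y} {i : Y ⟶ Z}
    (hj : E.ExtOrthogonal j (m ≫ φ)) (hi : E.ExtOrthogonal i (s ≫ e)) :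
    E.ExtOrthogonal (j ≫ i) (s ≫ φ) := by
  rw [extOrthogonal_iff_factor_left]
  intro A₀ B m₀ e₀ n q w₀ wn a₁ h₀ hn ha ha'
  obtain ⟨B₁, n₁, q₁, c₁, w₁, hp₁, hc₁, h₁⟩ := Conflation.exists_pullback hn i
  obtain ⟨k, hk⟩ := (extOrthogonal_iff_factor_left _ _).1 hi _ _ n₁ q₁ n q w₁ wn c₁ h₁ hn hc₁
    hp₁.w.symm
  obtain ⟨R, c₂, n₂, q₂, w₂, hp₂, hc₂, h₂⟩ := Conflation.exists_pushout h₁ s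
  obtain ⟨N, m', e', c₃, w₃, h₃, hm₃, he₃⟩ := Conflation.exists_of_pushout_split h h₂
    (hp₂.desc k e hk) (hp₂.inr_desc _ _ _)
  obtain ⟨R', c₄, n₄, q₄, w₄, hp₄, hc₄, h₄⟩ := Conflation.exists_pushout h₂ φ
  obtain ⟨g, hg⟩ := (extOrthogonal_iff_factor_right _ _).1 hj _ _ n₄ q₄ m' e' w₄ w₃ (c₃ ≫ c₄)
    h₄ h₃ (by rw [← Category.assoc, hm₃, Category.assoc, hp₄.w, Category.assoc])
    (by rw [Category.assoc, hc₄, he₃])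
  have hb : (e₀ ≫ j) ≫ i = a₁ ≫ q := by rw [ha', Category.assoc]
  have hb₁ : hp₁.lift (e₀ ≫ j) a₁ hb ≫ q₁ = e₀ ≫ j := hp₁.lift_fst _ _ _
  have hb₂ : m₀ ≫ hp₁.lift (e₀ ≫ j) a₁ hb = n₁ := hp₁.hom_ext
    (by rw [Category.assoc, hp₁.lift_fst, ← Category.assoc, w₀, zero_comp, w₁])
    (by rw [Category.assoc, hp₁.lift_snd, ha, hc₁])
  generalize hp₁.lift (e₀ ≫ j) a₁ hb = b at hb₁ hb₂
  -- Both maps from `A₀` to `R'` lie over `e₀ ≫ j`, so their difference lands in `X'`. On `X` the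
  -- term `e₀ ≫ g` vanishes, leaving `s ≫ φ`.
  obtain ⟨t, ht⟩ := Conflation.exists_lift h₄ (b ≫ c₂ ≫ c₄ - e₀ ≫ g) (by
    rw [Preadditive.sub_comp, Category.assoc, Category.assoc, Category.assoc, hc₄, hc₂, hb₁, hg,
      sub_self])
  have := Conflation.mono h₄
  refine ⟨t, ?_⟩
  rw [← cancel_mono n₄, Category.assoc, ht, Preadditive.comp_sub, ← Category.assoc, hb₂,
    ← Category.assoc, hp₂.w, ← Category.assoc m₀, w₀, zero_comp, sub_zero, Category.assoc, hp₄.w,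
    Category.assoc]

/-- The dual chase uses exactness in the first variable: after pushout along `x` the pullback to `L`
splits, so the extension of `Q` comes from one of `P`, which `s ≫ e` and `y` together split. -/
lemma ExtOrthogonal.comp_right {L Q P X X' W W₁ W₂ : A} {m : L ⟶ Q} {e : Q ⟶ P} {w : m ≫ e = 0}
    (h : E.Conflation (ShortComplex.mk m e w)) {s : X ⟶ Q} {φ : Q ⟶ X'} {x : W ⟶ W₁}
    {y : W₁ ⟶ W₂} (hx : E.ExtOrthogonal (m ≫ φ) x) (hy : E.ExtOrthogonal (s ≫ e) y) :
    E.ExtOrthogonal (s ≫ φ) (x ≫ y) := by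
  rw [extOrthogonal_iff_factor_right]
  intro A₁ B m₁ e₁ n q wm wn a₂ h₁ hn ha ha'
  obtain ⟨B₁, c₁, n₁, q₁, w₁, hp₁, hc₁, hB₁⟩ := Conflation.exists_pushout hn x
  obtain ⟨k, hk⟩ := (extOrthogonal_iff_factor_right _ _).1 hx _ _ n₁ q₁ n q w₁ wn c₁ hB₁ hn
    hp₁.w hc₁
  obtain ⟨R, n₂, q₂, c₂, w₂, hp₂, hc₂, h₂⟩ := Conflation.exists_pullback hB₁ φ
  obtain ⟨N, m', e', c₃, w₃, h₃, hm₃, he₃⟩ := Conflation.exists_of_pullback_split h h₂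
    (hp₂.lift m k hk.symm) (hp₂.lift_fst _ _ _)
  obtain ⟨R', n₄, q₄, c₄, w₄, hp₄, hc₄, h₄⟩ := Conflation.exists_pullback h₂ s
  obtain ⟨g, hg⟩ := (extOrthogonal_iff_factor_left _ _).1 hy _ _ n₄ q₄ m' e' w₄ w₃ (c₄ ≫ c₃)
    h₄ h₃ (by rw [← Category.assoc, hc₄, hm₃])
    (by rw [Category.assoc, he₃, ← Category.assoc, ← hp₄.w, Category.assoc])
  have hb : n ≫ a₂ = x ≫ y ≫ m₁ := by rw [ha, Category.assoc]
  have hb₁ : n₁ ≫ hp₁.desc a₂ (y ≫ m₁) hb = y ≫ m₁ := hp₁.inr_desc _ _ _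
  have hb₂ : hp₁.desc a₂ (y ≫ m₁) hb ≫ e₁ = q₁ := hp₁.hom_ext
    (by rw [← Category.assoc, hp₁.inl_desc, ha', hc₁])
    (by rw [← Category.assoc, hp₁.inr_desc, Category.assoc, wm, comp_zero, w₁])
  generalize hp₁.desc a₂ (y ≫ m₁) hb = b at hb₁ hb₂
  obtain ⟨t, ht⟩ := Conflation.exists_desc h₄ (c₄ ≫ c₂ ≫ b - g ≫ m₁) (by
    rw [Preadditive.comp_sub, ← Category.assoc, hc₄, ← Category.assoc, hc₂, hb₁, ← Category.assoc,
      hg, sub_self])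
  have := Conflation.epi h₄
  refine ⟨t, ?_⟩
  rw [← cancel_epi q₄, ← Category.assoc, ht, Preadditive.sub_comp, Category.assoc, Category.assoc,
    Category.assoc, hb₂, wm, comp_zero, sub_zero, ← hp₂.w, ← Category.assoc, ← hp₄.w,
    Category.assoc]

/-! ### Double perpendiculars and factorization through approximations -/

lemma mem_leftPerp_rightPerp {I : MorphismIdeal A} {X Y : A} {f : X ⟶ Y} (hf : f ∈ I.hom X Y) :
    f ∈ (E.leftPerp (E.rightPerp I)).hom X Y :=
  fun _ _ _ hj => hj _ _ f hf

lemma mem_rightPerp_leftPerp {I : MorphismIdeal A} {X Y : A} {f : X ⟶ Y} (hf : f ∈ I.hom X Y) :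
    f ∈ (E.rightPerp (E.leftPerp I)).hom X Y :=
  fun _ _ _ hi => hi _ _ f hf

/-- The obstruction to lifting `f` through `i` is the pullback along `f` of an extension pushed out
along a morphism `k` of `I^⊥`; it vanishes as `Ext(f, k) = 0`. -/
lemma IsSpecialPrecover.exists_factor {I : MorphismIdeal A} {C X Y : A} {i : C ⟶ X}
    (hi : E.IsSpecialPrecover I i) {f : Y ⟶ X}
    (hf : f ∈ (E.leftPerp (E.rightPerp I)).hom Y X) : ∃ s : Y ⟶ C, s ≫ i = f := by
  obtain ⟨-, K₀, K₁, C₀, k, c, m₀, i₀, m₁, w₀, w₁, h₀, h₁, hp, hc, hk⟩ := hi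
  exact (extOrthogonal_iff_factor_right _ _).1 (hf _ _ k hk) _ _ m₁ i m₀ i₀ w₁ w₀ c h₁ h₀ hp.w hc

lemma IsSpecialPreenvelope.exists_factor {J : MorphismIdeal A} {C X Y : A} {j : X ⟶ C}
    (hj : E.IsSpecialPreenvelope J j) {f : X ⟶ Y}
    (hf : f ∈ (E.rightPerp (E.leftPerp J)).hom X Y) : ∃ s : C ⟶ Y, j ≫ s = f := by
  obtain ⟨-, K₀, K₁, C₀, k, c, j₀, e₀, e₁, w₀, w₁, h₀, h₁, hp, hc, hk⟩ := hj
  exact (extOrthogonal_iff_factor_left _ _).1 (hf _ _ k hk) _ _ j e₁ j₀ e₀ w₁ w₀ c h₁ h₀ hc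
    hp.w.symm

lemma IsSpecialPrecovering.leftPerp_rightPerp {I : MorphismIdeal A}
    (hI : E.IsSpecialPrecovering I) : E.leftPerp (E.rightPerp I) = I := by
  refine MorphismIdeal.ext_of_mem_iff fun Y X f => ⟨fun hf => ?_, mem_leftPerp_rightPerp⟩
  obtain ⟨C, i, hi⟩ := hI X
  obtain ⟨s, rfl⟩ := hi.exists_factor hf
  exact I.precomp_mem s hi.1

lemma IsSpecialPreenveloping.rightPerp_leftPerp {J : MorphismIdeal A}
    (hJ : E.IsSpecialPreenveloping J) : E.rightPerp (E.leftPerp J) = J := by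
  refine MorphismIdeal.ext_of_mem_iff fun X Y f => ⟨fun hf => ?_, mem_rightPerp_leftPerp⟩
  obtain ⟨C, j, hj⟩ := hJ X
  obtain ⟨s, rfl⟩ := hj.exists_factor hf
  exact J.postcomp_mem s hj.1

/-! ### Salce's Lemma -/

/-- Salce's Lemma: the pullback of an injective inflation `X ⟶ Y` along a special `I`-precover of
its cokernel gives a morphism from `X` that lies in `I^⊥`. -/
lemma IsSpecialPrecovering.exists_pullback (hinj : E.HasEnoughInjectiveMorphisms)
    {I : MorphismIdeal A} (hI : E.IsSpecialPrecovering I) (X : A) :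
    ∃ (Y Z C P : A) (x : X ⟶ Y) (y : Y ⟶ Z) (i : C ⟶ Z) (g : X ⟶ P) (p : P ⟶ C) (c : P ⟶ Y)
      (wx : x ≫ y = 0) (wg : g ≫ p = 0), E.Conflation (ShortComplex.mk x y wx) ∧
      E.Conflation (ShortComplex.mk g p wg) ∧ IsPullback p c i y ∧ g ≫ c = x ∧
      i ∈ I.hom C Z ∧ g ∈ (E.rightPerp I).hom X P := by
  obtain ⟨Y, x, ⟨Z, y, wx, hx⟩, hxinj⟩ := hinj X
  obtain ⟨C, i, hi⟩ := hI Z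
  obtain ⟨P, g, p, c, wg, hp, hc, hg⟩ := Conflation.exists_pullback hx i
  refine ⟨Y, Z, C, P, x, y, i, g, p, c, wx, wg, hx, hg, hp, hc, hi.1, fun W V i' hi' => ?_⟩
  rw [extOrthogonal_iff_factor_left]
  intro A₀ B m₀ e₀ m e w₀ w a₁ h₀ h ha ha'
  -- Orthogonality of `x` to the identity of `V` extends `x` over `B`. The map `t` induced on
  -- cokernels, preceded by `i'`, lies in `I` and so factors through the precover; the two pieces
  -- glue to a map into the pullback `P`.
  obtain ⟨b, hb⟩ := (extOrthogonal_iff_factor_left _ _).1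
    (hxinj _ _ (𝟙 V) (AddSubgroup.mem_top _)) _ _ m e m e w w (𝟙 B) h h (Category.comp_id _)
    (by rw [Category.comp_id, Category.id_comp])
  obtain ⟨t, ht⟩ := Conflation.exists_desc h (b ≫ y) (by rw [← Category.assoc, hb, wx])
  obtain ⟨s, hs⟩ := hi.exists_factor (mem_leftPerp_rightPerp (E := E) (I.postcomp_mem t hi'))
  have hw : (e₀ ≫ s) ≫ i = (a₁ ≫ b) ≫ y := by
    rw [Category.assoc, hs, ← Category.assoc, ← ha', Category.assoc, ht, Category.assoc]
  refine ⟨hp.lift (e₀ ≫ s) (a₁ ≫ b) hw, hp.hom_ext ?_ ?_⟩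
  · rw [Category.assoc, hp.lift_fst, ← Category.assoc, w₀, zero_comp, wg]
  · rw [Category.assoc, hp.lift_snd, ← Category.assoc, ha, hb, hc]

/-- Salce's Lemma: the pushout of a projective deflation `Y ⟶ X` along a special `J`-preenvelope
of its kernel gives a morphism to `X` that lies in `^⊥J`. -/
lemma IsSpecialPreenveloping.exists_pushout (hproj : E.HasEnoughProjectiveMorphisms)
    {J : MorphismIdeal A} (hJ : E.IsSpecialPreenveloping J) (X : A) :
    ∃ (Y Z C P : A) (x : Z ⟶ Y) (y : Y ⟶ X) (j : Z ⟶ C) (p : C ⟶ P) (g : P ⟶ X) (c : Y ⟶ P)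
      (wx : x ≫ y = 0) (wg : p ≫ g = 0), E.Conflation (ShortComplex.mk x y wx) ∧
      E.Conflation (ShortComplex.mk p g wg) ∧ IsPushout x j c p ∧ c ≫ g = y ∧
      j ∈ J.hom Z C ∧ g ∈ (E.leftPerp J).hom P X := by
  obtain ⟨Y, y, ⟨Z, x, wx, hx⟩, hyproj⟩ := hproj X
  obtain ⟨C, j, hj⟩ := hJ Z
  obtain ⟨P, c, p, g, wg, hp, hc, hg⟩ := Conflation.exists_pushout hx j
  refine ⟨Y, Z, C, P, x, y, j, p, g, c, wx, wg, hx, hg, hp, hc, hj.1, fun W V j' hj' => ?_⟩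
  rw [extOrthogonal_iff_factor_right]
  intro A₁ B m₁ e₁ m e w₁ w a₂ h₁ h ha ha'
  obtain ⟨b, hb⟩ := (extOrthogonal_iff_factor_right _ _).1
    (hyproj _ _ (𝟙 W) (AddSubgroup.mem_top _)) _ _ m e m e w w (𝟙 B) h h
    (by rw [Category.comp_id, Category.id_comp]) (Category.id_comp _)
  obtain ⟨t, ht⟩ := Conflation.exists_lift h (x ≫ b) (by rw [Category.assoc, hb, wx])
  obtain ⟨s, hs⟩ := hj.exists_factor (mem_rightPerp_leftPerp (E := E) (J.precomp_mem t hj'))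
  have hw : x ≫ b ≫ a₂ = j ≫ s ≫ m₁ := by
    rw [← Category.assoc, ← Category.assoc, ← ht, hs, Category.assoc, ha, Category.assoc]
  refine ⟨hp.desc (b ≫ a₂) (s ≫ m₁) hw, hp.hom_ext ?_ ?_⟩
  · rw [← Category.assoc, hp.inl_desc, Category.assoc, ha', hb, hc]
  · rw [← Category.assoc, hp.inr_desc, Category.assoc, w₁, comp_zero, wg]

lemma IsSpecialPrecovering.rightPerp (hinj : E.HasEnoughInjectiveMorphisms)
    {I : MorphismIdeal A} (hI : E.IsSpecialPrecovering I) :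
    E.IsSpecialPreenveloping (E.rightPerp I) := by
  intro X
  obtain ⟨Y, Z, C, P, x, y, i, g, p, c, wx, wg, hx, hg, hp, hc, hi, hgI⟩ :=
    hI.exists_pullback hinj X
  exact ⟨P, g, hgI, Z, C, Y, i, c, x, y, p, wx, wg, hx, hg, hp, hc, mem_leftPerp_rightPerp hi⟩

lemma IsSpecialPreenveloping.leftPerp (hproj : E.HasEnoughProjectiveMorphisms)
    {J : MorphismIdeal A} (hJ : E.IsSpecialPreenveloping J) :
    E.IsSpecialPrecovering (E.leftPerp J) := by
  intro X
  obtain ⟨Y, Z, C, P, x, y, j, p, g, c, wx, wg, hx, hg, hp, hc, hj, hgJ⟩ :=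
    hJ.exists_pushout hproj X
  exact ⟨P, g, hgJ, Z, C, Y, j, c, x, y, p, wx, wg, hx, hg, hp, hc, mem_rightPerp_leftPerp hj⟩

/-! ### The Ghost Lemma -/

/-- The ideal of the morphisms that are right `Ext`-orthogonal to a class of morphisms. -/
def rightOrthogonal (E : ExactStructure A) (M : MorphismProperty A) : MorphismIdeal A where
  hom X Y :=
    { carrier := {j | ∀ (X' Y' : A) (i : X' ⟶ Y'), M i → E.ExtOrthogonal i j}
      zero_mem' := fun X' Y' i _ => by
        rw [extOrthogonal_iff_factor_left]
        intros
        exact ⟨0, comp_zero⟩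
      add_mem' := fun {a b} ha hb X' Y' i hi => by
        have ha' := ha X' Y' i hi
        have hb' := hb X' Y' i hi
        rw [extOrthogonal_iff_factor_left] at ha' hb' ⊢
        intro A₀ B m₀ e₀ m e w₀ w a₁ h₀ h hm he
        obtain ⟨k, hk⟩ := ha' A₀ B m₀ e₀ m e w₀ w a₁ h₀ h hm he
        obtain ⟨l, hl⟩ := hb' A₀ B m₀ e₀ m e w₀ w a₁ h₀ h hm he
        exact ⟨k + l, by rw [Preadditive.comp_add, hk, hl]⟩
      neg_mem' := fun {a} ha X' Y' i hi => by
        have ha' := ha X' Y' i hi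
        rw [extOrthogonal_iff_factor_left] at ha' ⊢
        intro A₀ B m₀ e₀ m e w₀ w a₁ h₀ h hm he
        obtain ⟨k, hk⟩ := ha' A₀ B m₀ e₀ m e w₀ w a₁ h₀ h hm he
        exact ⟨-k, by rw [Preadditive.comp_neg, hk]⟩ }
  precomp_mem s _ hf X' Y' i hi := (hf X' Y' i hi).precomp_right s
  postcomp_mem r hf X' Y' i hi := by
    have hf' := hf X' Y' i hi
    rw [extOrthogonal_iff_factor_left] at hf' ⊢
    intro A₀ B m₀ e₀ m e w₀ w a₁ h₀ h hm he
    obtain ⟨k, hk⟩ := hf' A₀ B m₀ e₀ m e w₀ w a₁ h₀ h hm he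
    exact ⟨k ≫ r, by rw [← Category.assoc, hk]⟩

/-- Orthogonal classes of morphisms generate orthogonal ideals. -/
lemma extOrthogonal_of_mem_span {M N : MorphismProperty A}
    (H : ∀ {X Y X' Y' : A} (a : X ⟶ Y) (x : X' ⟶ Y'), M a → N x → E.ExtOrthogonal a x)
    {X Y X' Y' : A} {a : X ⟶ Y} {x : X' ⟶ Y'} (ha : a ∈ (MorphismIdeal.span M).hom X Y)
    (hx : x ∈ (MorphismIdeal.span N).hom X' Y') : E.ExtOrthogonal a x := by
  -- Each side's orthogonal is an ideal, so the generators may be replaced by the ideals they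
  -- generate one side at a time.
  refine MorphismIdeal.span_le (I := E.leftPerp (MorphismIdeal.span N)) ?_ ha _ _ x hx
  intro U V b hb W T y hy
  exact MorphismIdeal.span_le (I := E.rightOrthogonal M)
    (fun _ _ z hz _ _ c hc => H c z hc hz) hy _ _ b hb

/-- The Ghost Lemma: `I J` and `K ◇ L` are orthogonal if `J`, `K` and `I`, `L` are. -/
lemma extOrthogonal_mul_extIdeal {I J K L : MorphismIdeal A}
    (hJK : ∀ {X Y X' Y' : A} (a : X ⟶ Y) (x : X' ⟶ Y'), a ∈ J.hom X Y → x ∈ K.hom X' Y' →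
      E.ExtOrthogonal a x)
    (hIL : ∀ {X Y X' Y' : A} (a : X ⟶ Y) (x : X' ⟶ Y'), a ∈ I.hom X Y → x ∈ L.hom X' Y' →
      E.ExtOrthogonal a x)
    {X Y X' Y' : A} {a : X ⟶ Y} {x : X' ⟶ Y'} (ha : a ∈ (I * J).hom X Y)
    (hx : x ∈ (E.extIdeal K L).hom X' Y') : E.ExtOrthogonal a x := by
  refine extOrthogonal_of_mem_span ?_ ha hx
  rintro _ _ _ _ _ x ⟨_, j, i, hj, hi, rfl⟩ ⟨_, _, _, _, k, l, hk, hl, ⟨ξ⟩⟩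
  rw [← ξ.a₁_a₂]
  refine ExtOrthogonal.comp_left ξ.conflation (hJK _ _ hj ?_) (hIL _ _ hi ?_)
  · rw [ξ.m_a₂]
    exact K.postcomp_mem _ hk
  · rw [ξ.a₁_e]
    exact L.precomp_mem _ hl

/-- The dual Ghost Lemma: `I ◇ J` and `K L` are orthogonal if `I`, `L` and `J`, `K` are. -/
lemma extOrthogonal_extIdeal_mul {I J K L : MorphismIdeal A}
    (hIL : ∀ {X Y X' Y' : A} (a : X ⟶ Y) (x : X' ⟶ Y'), a ∈ I.hom X Y → x ∈ L.hom X' Y' →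
      E.ExtOrthogonal a x)
    (hJK : ∀ {X Y X' Y' : A} (a : X ⟶ Y) (x : X' ⟶ Y'), a ∈ J.hom X Y → x ∈ K.hom X' Y' →
      E.ExtOrthogonal a x)
    {X Y X' Y' : A} {a : X ⟶ Y} {x : X' ⟶ Y'} (ha : a ∈ (E.extIdeal I J).hom X Y)
    (hx : x ∈ (K * L).hom X' Y') : E.ExtOrthogonal a x := by
  refine extOrthogonal_of_mem_span ?_ ha hx
  rintro _ _ _ _ x _ ⟨_, _, _, _, i, j, hi, hj, ⟨ξ⟩⟩ ⟨_, l, k, hl, hk, rfl⟩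
  rw [← ξ.a₁_a₂]
  refine ExtOrthogonal.comp_right ξ.conflation (hIL _ _ ?_ hl) (hJK _ _ ?_ hk)
  · rw [ξ.m_a₂]
    exact I.postcomp_mem _ hi
  · rw [ξ.a₁_e]
    exact J.precomp_mem _ hj

/-! ### Perpendiculars of products -/

/-- This is the converse of the Ghost Lemma. Since `Ext(j₁ ≫ i, f) = 0`, the map `j₁ ≫ i` lifts to
the pushout `Y'` along `f` of an injective inflation. The lift makes `f` factor through a conflation
`L₀ → Q → P` whose outer composites lie in `J^⊥` and `I^⊥`. -/
lemma mem_extIdeal_of_mem_rightPerp_mul (hinj : E.HasEnoughInjectiveMorphisms)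
    {I J : MorphismIdeal A} (hI : E.IsSpecialPrecovering I) (hJ : E.IsSpecialPrecovering J)
    {X X' : A} {f : X ⟶ X'} (hf : f ∈ (E.rightPerp (I * J)).hom X X') :
    f ∈ (E.extIdeal (E.rightPerp J) (E.rightPerp I)).hom X X' := by
  obtain ⟨Y, Z, C, P, x, y, i, g, p, c, wx, wg, hx, hg, hp, hc, hi, hgI⟩ :=
    hI.exists_pullback hinj X
  obtain ⟨D₁, j₁, hj₁, L₀, L₁, D₀, l, d, m₀, i₀, m₁, w₀, w₁, h₀, h₁, hpd, hd, hl⟩ := hJ C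
  obtain ⟨Y', b, x', y', w', hpf, hb, hx'⟩ := Conflation.exists_pushout hx f
  obtain ⟨t, ht⟩ := (extOrthogonal_iff_factor_right _ _).1
    (hf _ _ _ (MorphismIdeal.comp_mem_mul hj₁ hi)) _ _ x' y' x y w' wx b hx' hx hpf.w hb
  obtain ⟨Q, mQ, eQ, cQ, wQ, hpQ, hmQ, hQ⟩ := Conflation.exists_pullback h₀ p
  -- The routes from `Q` to `Y'` through `P` and through `D₀` agree in `Z`, so their difference
  -- factors through `X'`.
  obtain ⟨φ, hφ⟩ := Conflation.exists_lift hx' (eQ ≫ c ≫ b - cQ ≫ d ≫ t) (by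
    simp only [Preadditive.sub_comp, Category.assoc]
    rw [hb, ht, ← hp.w, reassoc_of% hd, ← reassoc_of% hpQ.w, sub_self])
  obtain ⟨u, hu⟩ := Conflation.exists_lift hx' (m₁ ≫ t) (by
    rw [Category.assoc, ht, reassoc_of% w₁, zero_comp])
  -- The component `0` in `D₀` removes the second route, so that `s ≫ φ` is exactly `f`.
  have hs : g ≫ p = 0 ≫ i₀ := by rw [wg, zero_comp]
  have hs₁ := hpQ.lift_fst _ _ hs
  have hs₂ := hpQ.lift_snd _ _ hs
  generalize hpQ.lift g 0 hs = s at hs₁ hs₂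
  have := Conflation.mono hx'
  have hf' : f = s ≫ φ := by
    rw [← cancel_mono x', Category.assoc, hφ, Preadditive.comp_sub, reassoc_of% hs₁,
      reassoc_of% hs₂, zero_comp, sub_zero, reassoc_of% hc, hpf.w]
  have hmφ : mQ ≫ φ = -(l ≫ u) := by
    rw [← cancel_mono x', Category.assoc, hφ, Preadditive.comp_sub, reassoc_of% wQ, zero_comp,
      zero_sub, reassoc_of% hmQ, reassoc_of% hpd.w, Preadditive.neg_comp, Category.assoc, hu]
  rw [hf']
  refine comp_mem_extIdeal hQ ?_ ?_
  · rw [hmφ]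
    exact neg_mem ((E.rightPerp J).postcomp_mem u hl)
  · rwa [hs₁]

lemma mem_extIdeal_of_mem_leftPerp_mul (hproj : E.HasEnoughProjectiveMorphisms)
    {K L : MorphismIdeal A} (hK : E.IsSpecialPreenveloping K) (hL : E.IsSpecialPreenveloping L)
    {X X' : A} {f : X' ⟶ X} (hf : f ∈ (E.leftPerp (K * L)).hom X' X) :
    f ∈ (E.extIdeal (E.leftPerp L) (E.leftPerp K)).hom X' X := by
  obtain ⟨Y, Z, C, P, x, y, l, p, g, c, wx, wg, hx, hg, hp, hc, hl, hgL⟩ :=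
    hL.exists_pushout hproj X
  obtain ⟨D₁, j₁, hj₁, M₀, M₁, D₀, k, d, j₀, e₀, e₁, w₀, w₁, h₀, h₁, hpd, hd, hk⟩ := hK C
  obtain ⟨Y', x', y', b, w', hpf, hb, hx'⟩ := Conflation.exists_pullback hx f
  obtain ⟨t, ht⟩ := (extOrthogonal_iff_factor_left _ _).1
    (hf _ _ _ (MorphismIdeal.comp_mem_mul hl hj₁)) _ _ x' y' x y w' wx b hx' hx hb hpf.w.symm
  obtain ⟨Q, cQ, mQ, eQ, wQ, hpQ, heQ, hQ⟩ := Conflation.exists_pushout h₀ p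
  obtain ⟨φ, hφ⟩ := Conflation.exists_desc hx' (b ≫ c ≫ mQ - t ≫ d ≫ cQ) (by
    rw [Preadditive.comp_sub, reassoc_of% hb, reassoc_of% ht, reassoc_of% hd, hpQ.w,
      reassoc_of% hp.w, sub_self])
  obtain ⟨u, hu⟩ := Conflation.exists_desc hx' (t ≫ e₁) (by
    rw [reassoc_of% ht, w₁, comp_zero])
  have hs : j₀ ≫ 0 = p ≫ g := by rw [wg, comp_zero]
  have hs₁ := hpQ.inl_desc _ _ hs
  have hs₂ := hpQ.inr_desc _ _ hs
  generalize hpQ.desc 0 g hs = s at hs₁ hs₂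
  have := Conflation.epi hx'
  have hf' : f = φ ≫ s := by
    rw [← cancel_epi y', ← Category.assoc, hφ]
    simp only [Preadditive.sub_comp, Category.assoc]
    rw [hs₁, hs₂, comp_zero, comp_zero, sub_zero, hc, hpf.w]
  have hφe : φ ≫ eQ = -(u ≫ k) := by
    rw [← cancel_epi y', ← Category.assoc, hφ]
    simp only [Preadditive.sub_comp, Category.assoc, Preadditive.comp_neg]
    rw [wQ, comp_zero, comp_zero, zero_sub, heQ, ← hpd.w, reassoc_of% hu]
  rw [hf']
  refine comp_mem_extIdeal hQ ?_ ?_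
  · rwa [hs₂]
  · rw [hφe]
    exact neg_mem ((E.leftPerp K).precomp_mem u hk)

lemma rightPerp_mul (hinj : E.HasEnoughInjectiveMorphisms) {I J : MorphismIdeal A}
    (hI : E.IsSpecialPrecovering I) (hJ : E.IsSpecialPrecovering J) :
    E.rightPerp (I * J) = E.extIdeal (E.rightPerp J) (E.rightPerp I) :=
  MorphismIdeal.ext_of_mem_iff fun _ _ _ =>
    ⟨mem_extIdeal_of_mem_rightPerp_mul hinj hI hJ, fun hx _ _ _ ha =>
      extOrthogonal_mul_extIdeal (I := I) (J := J) (K := E.rightPerp J) (L := E.rightPerp I)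
        (fun a _ ha hx => hx _ _ a ha) (fun a _ ha hx => hx _ _ a ha) ha hx⟩

lemma leftPerp_mul (hproj : E.HasEnoughProjectiveMorphisms) {K L : MorphismIdeal A}
    (hK : E.IsSpecialPreenveloping K) (hL : E.IsSpecialPreenveloping L) :
    E.leftPerp (K * L) = E.extIdeal (E.leftPerp L) (E.leftPerp K) :=
  MorphismIdeal.ext_of_mem_iff fun _ _ _ =>
    ⟨mem_extIdeal_of_mem_leftPerp_mul hproj hK hL, fun ha _ _ _ hx =>
      extOrthogonal_extIdeal_mul (I := E.leftPerp L) (J := E.leftPerp K) (K := K) (L := L)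
        (fun _ x ha hx => ha _ _ x hx) (fun _ x ha hx => ha _ _ x hx) ha hx⟩

/-! ### Products of special precovering and preenveloping ideals -/

/-- A deflation in `I` that receives a conflation through a morphism of `I^⊥` between the
left terms yields a special `I`-precover. -/
lemma exists_isSpecialPrecover {I : MorphismIdeal A} {K₀ K₁ C₀ C₁ X : A} {m₀ : K₀ ⟶ C₀}
    {i₀ : C₀ ⟶ X} {w₀ : m₀ ≫ i₀ = 0} (h₀ : E.Conflation (ShortComplex.mk m₀ i₀ w₀))
    {k : K₀ ⟶ K₁} (hk : k ∈ (E.rightPerp I).hom K₀ K₁) {c : C₀ ⟶ C₁} {m₁ : K₁ ⟶ C₁}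
    {i₁ : C₁ ⟶ X} (hi₁ : i₁ ∈ I.hom C₁ X) (hw : m₀ ≫ c = k ≫ m₁) (w₁ : m₁ ≫ i₁ = 0)
    (hc : c ≫ i₁ = i₀) : ∃ (C : A) (i : C ⟶ X), E.IsSpecialPrecover I i := by
  obtain ⟨C, c', m, i, w, hp, hc', h⟩ := Conflation.exists_pushout h₀ k
  have hi : hp.desc c m₁ hw ≫ i₁ = i := hp.hom_ext
    (by rw [← Category.assoc, hp.inl_desc, hc, hc'])
    (by rw [← Category.assoc, hp.inr_desc, w₁, w])
  exact ⟨C, i, hi ▸ I.precomp_mem _ hi₁, K₀, K₁, C₀, k, c', m₀, i₀, m, w₀, w, h₀, h, hp, hc', hk⟩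

/-- An inflation in `J` that maps to a conflation through a morphism of `^⊥J` between the
right terms yields a special `J`-preenvelope. -/
lemma exists_isSpecialPreenvelope {J : MorphismIdeal A} {K₀ K₁ C₀ C₁ X : A} {j₀ : X ⟶ C₀}
    {e₀ : C₀ ⟶ K₀} {w₀ : j₀ ≫ e₀ = 0} (h₀ : E.Conflation (ShortComplex.mk j₀ e₀ w₀))
    {k : K₁ ⟶ K₀} (hk : k ∈ (E.leftPerp J).hom K₁ K₀) {c : C₁ ⟶ C₀} {j₁ : X ⟶ C₁}
    {e₁ : C₁ ⟶ K₁} (hj₁ : j₁ ∈ J.hom X C₁) (hw : e₁ ≫ k = c ≫ e₀) (w₁ : j₁ ≫ e₁ = 0)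
    (hc : j₁ ≫ c = j₀) : ∃ (C : A) (j : X ⟶ C), E.IsSpecialPreenvelope J j := by
  obtain ⟨C, j, e, c', w, hp, hc', h⟩ := Conflation.exists_pullback h₀ k
  have hj : j₁ ≫ hp.lift e₁ c hw = j := hp.hom_ext
    (by rw [Category.assoc, hp.lift_fst, w₁, w])
    (by rw [Category.assoc, hp.lift_snd, hc, hc'])
  exact ⟨C, j, hj ▸ J.postcomp_mem _ hj₁, K₀, K₁, C₀, k, c', j₀, e₀, e, w₀, w, h₀, h, hp, hc', hk⟩

/-- A special `J`-precover of the domain of a special `I`-precover composes with it to a deflation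
in `I J`. The map of kernels passes through an extension `N` of `K₁` by `L₀`, hence lies in `J^⊥ ◇
I^⊥ = (I J)^⊥`. -/
lemma IsSpecialPrecovering.mul (hinj : E.HasEnoughInjectiveMorphisms) {I J : MorphismIdeal A}
    (hI : E.IsSpecialPrecovering I) (hJ : E.IsSpecialPrecovering J) :
    E.IsSpecialPrecovering (I * J) := by
  intro X
  obtain ⟨C₁, i₁, hi₁, K₀, K₁, C₀, k, c, m₀, i₀, m₁, w₀, w₁, h₀, h₁, hpc, hc, hk⟩ := hI X
  obtain ⟨D₁, j₁, hj₁, L₀, L₁, D₀, l, d, n₀, j₀, n₁, v₀, v₁, g₀, g₁, hpd, hd, hl⟩ := hJ C₁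
  obtain ⟨D', n', q', c', w', hp', hn', h'⟩ := Conflation.exists_pullback g₀ c
  obtain ⟨M₀, μ, wμ, hμ⟩ := E.deflation_comp q' i₀ ⟨L₀, n', w', h'⟩ ⟨K₀, m₀, w₀, h₀⟩
  obtain ⟨N, mN, eN, cN, wN, hpN, hmN, hN⟩ := Conflation.exists_pullback g₀ m₁
  obtain ⟨M₁, mM, eM, cM, wM, hpM, hmM, hM⟩ := Conflation.exists_pullback g₁ m₁
  obtain ⟨r, hr⟩ := Conflation.exists_lift h₀ (μ ≫ q') (by rw [Category.assoc, wμ])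
  -- The kernel map `M₀ ⟶ M₁` is split into `s`, which over `K₁` is a multiple of `k`, and `φ`,
  -- which on `L₀` is a multiple of `l`.
  have hs : (r ≫ k) ≫ m₁ = (μ ≫ c') ≫ j₀ := by
    rw [Category.assoc, ← hpc.w, reassoc_of% hr, hp'.w, Category.assoc]
  have hs₁ := hpN.lift_fst _ _ hs
  have hs₂ := hpN.lift_snd _ _ hs
  generalize hpN.lift (r ≫ k) (μ ≫ c') hs = s at hs₁ hs₂
  have hφ : eN ≫ m₁ = (cN ≫ d) ≫ j₁ := by rw [hpN.w, Category.assoc, hd]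
  have hφ₁ := hpM.lift_fst _ _ hφ
  have hφ₂ := hpM.lift_snd _ _ hφ
  generalize hpM.lift eN (cN ≫ d) hφ = φ at hφ₁ hφ₂
  have hmφ : mN ≫ φ = l ≫ mM := hpM.hom_ext
    (by rw [Category.assoc, hφ₁, wN, Category.assoc, wM, comp_zero])
    (by rw [Category.assoc, hφ₂, Category.assoc, hmM, reassoc_of% hmN, hpd.w])
  have hsφ : s ≫ φ ∈ (E.rightPerp (I * J)).hom M₀ M₁ := by
    rw [rightPerp_mul hinj hI hJ]
    refine comp_mem_extIdeal hN ?_ ?_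
    · rw [hmφ]
      exact (E.rightPerp J).postcomp_mem _ hl
    · rw [hs₁]
      exact (E.rightPerp I).precomp_mem _ hk
  refine exists_isSpecialPrecover hμ hsφ (c := c' ≫ d) (m₁ := cM)
    (MorphismIdeal.comp_mem_mul hj₁ hi₁) ?_ ?_ ?_
  · rw [Category.assoc, hφ₂, reassoc_of% hs₂]
  · rw [← reassoc_of% hpM.w, w₁, comp_zero]
  · rw [Category.assoc, reassoc_of% hd, ← reassoc_of% hp'.w, hc]

lemma IsSpecialPreenveloping.mul (hproj : E.HasEnoughProjectiveMorphisms) {K L : MorphismIdeal A}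
    (hK : E.IsSpecialPreenveloping K) (hL : E.IsSpecialPreenveloping L) :
    E.IsSpecialPreenveloping (K * L) := by
  intro X
  obtain ⟨C₁, i₁, hi₁, K₀, K₁, C₀, k, c, i₀, m₀, m₁, w₀, w₁, h₀, h₁, hpc, hc, hk⟩ := hL X
  obtain ⟨D₁, j₁, hj₁, L₀, L₁, D₀, l, d, j₀, n₀, n₁, v₀, v₁, g₀, g₁, hpd, hd, hl⟩ := hK C₁
  obtain ⟨D', c', q', n', w', hp', hn', h'⟩ := Conflation.exists_pushout g₀ c
  obtain ⟨M₀, μ, wμ, hμ⟩ := E.inflation_comp i₀ q' ⟨K₀, m₀, w₀, h₀⟩ ⟨L₀, n', w', h'⟩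
  obtain ⟨N, cN, mN, eN, wN, hpN, heN, hN⟩ := Conflation.exists_pushout g₀ m₁
  obtain ⟨M₁, cM, mM, eM, wM, hpM, heM, hM⟩ := Conflation.exists_pushout g₁ m₁
  obtain ⟨r, hr⟩ := Conflation.exists_desc h₀ (q' ≫ μ) (by rw [← Category.assoc, wμ])
  have hs : j₀ ≫ c' ≫ μ = m₁ ≫ k ≫ r := by
    rw [reassoc_of% hpc.w, hr, reassoc_of% hp'.w]
  have hs₁ := hpN.inl_desc _ _ hs
  have hs₂ := hpN.inr_desc _ _ hs
  generalize hpN.desc (c' ≫ μ) (k ≫ r) hs = s at hs₁ hs₂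
  have hφ : j₁ ≫ d ≫ cN = m₁ ≫ mN := by rw [reassoc_of% hd, hpN.w]
  have hφ₁ := hpM.inl_desc _ _ hφ
  have hφ₂ := hpM.inr_desc _ _ hφ
  generalize hpM.desc (d ≫ cN) mN hφ = φ at hφ₁ hφ₂
  have hφe : φ ≫ eN = eM ≫ l := hpM.hom_ext
    (by rw [reassoc_of% hφ₁, heN, reassoc_of% heM, hpd.w])
    (by rw [reassoc_of% hφ₂, wN, reassoc_of% wM, zero_comp])
  have hsφ : φ ≫ s ∈ (E.leftPerp (K * L)).hom M₁ M₀ := by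
    rw [leftPerp_mul hproj hK hL]
    refine comp_mem_extIdeal hN ?_ ?_
    · rw [hs₂]
      exact (E.leftPerp L).postcomp_mem _ hk
    · rw [hφe]
      exact (E.leftPerp K).precomp_mem _ hl
  refine exists_isSpecialPreenvelope hμ hsφ (c := d ≫ c') (e₁ := cM)
    (MorphismIdeal.comp_mem_mul hi₁ hj₁) ?_ ?_ ?_
  · rw [reassoc_of% hφ₁, hs₁, Category.assoc]
  · rw [Category.assoc, hpM.w, reassoc_of% w₁, zero_comp]
  · rw [Category.assoc, reassoc_of% hd, hp'.w, reassoc_of% hc]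

/-! ### Extension ideals by duality -/

/-- Writing `I ◇ J` as the left perpendicular of a product of special preenveloping ideals reduces
its properties to the product case. -/
lemma extIdeal_eq_leftPerp (hinj : E.HasEnoughInjectiveMorphisms)
    (hproj : E.HasEnoughProjectiveMorphisms) {I J : MorphismIdeal A}
    (hI : E.IsSpecialPrecovering I) (hJ : E.IsSpecialPrecovering J) :
    E.extIdeal I J = E.leftPerp (E.rightPerp J * E.rightPerp I) := by
  rw [leftPerp_mul hproj (hJ.rightPerp hinj) (hI.rightPerp hinj), hI.leftPerp_rightPerp,
    hJ.leftPerp_rightPerp]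

lemma IsSpecialPrecovering.extIdeal (hinj : E.HasEnoughInjectiveMorphisms)
    (hproj : E.HasEnoughProjectiveMorphisms) {I J : MorphismIdeal A}
    (hI : E.IsSpecialPrecovering I) (hJ : E.IsSpecialPrecovering J) :
    E.IsSpecialPrecovering (E.extIdeal I J) := by
  rw [extIdeal_eq_leftPerp hinj hproj hI hJ]
  exact ((hJ.rightPerp hinj).mul hproj (hI.rightPerp hinj)).leftPerp hproj

lemma rightPerp_extIdeal (hinj : E.HasEnoughInjectiveMorphisms)
    (hproj : E.HasEnoughProjectiveMorphisms) {I J : MorphismIdeal A}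
    (hI : E.IsSpecialPrecovering I) (hJ : E.IsSpecialPrecovering J) :
    E.rightPerp (E.extIdeal I J) = E.rightPerp J * E.rightPerp I := by
  rw [extIdeal_eq_leftPerp hinj hproj hI hJ]
  exact ((hJ.rightPerp hinj).mul hproj (hI.rightPerp hinj)).rightPerp_leftPerp

lemma IsSpecialPreenveloping.extIdeal (hinj : E.HasEnoughInjectiveMorphisms)
    (hproj : E.HasEnoughProjectiveMorphisms) {K L : MorphismIdeal A}
    (hK : E.IsSpecialPreenveloping K) (hL : E.IsSpecialPreenveloping L) :
    E.IsSpecialPreenveloping (E.extIdeal K L) := by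
  -- Applied to `^⊥L` and `^⊥K`, the product formula exhibits `K ◇ L` as the right perpendicular of
  -- a special precovering ideal.
  have h := rightPerp_mul hinj (hL.leftPerp hproj) (hK.leftPerp hproj)
  rw [hK.rightPerp_leftPerp, hL.rightPerp_leftPerp] at h
  rw [← h]
  exact ((hL.leftPerp hproj).mul hinj (hK.leftPerp hproj)).rightPerp hinj

end ExactStructure

theorem mainTheorem8 {A : Type u} [Category.{v} A] [Preadditive A] [HasFiniteBiproducts A]
    (E : ExactStructure A)
    (hinj : E.HasEnoughInjectiveMorphisms) (hproj : E.HasEnoughProjectiveMorphisms) :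
    (∀ I J : MorphismIdeal A, E.IsSpecialPrecovering I → E.IsSpecialPrecovering J →
      E.IsSpecialPrecovering (I * J) ∧ E.IsSpecialPrecovering (E.extIdeal I J)) ∧
    (∀ I J : MorphismIdeal A, E.IsSpecialPreenveloping I → E.IsSpecialPreenveloping J →
      E.IsSpecialPreenveloping (I * J) ∧ E.IsSpecialPreenveloping (E.extIdeal I J)) ∧
    Set.BijOn E.rightPerp {I | E.IsSpecialPrecovering I} {K | E.IsSpecialPreenveloping K} ∧
    (∀ I J : MorphismIdeal A, E.IsSpecialPrecovering I → E.IsSpecialPrecovering J →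
      E.rightPerp (I * J) = E.extIdeal (E.rightPerp J) (E.rightPerp I) ∧
      E.rightPerp (E.extIdeal I J) = E.rightPerp J * E.rightPerp I) := by
  refine ⟨fun I J hI hJ => ⟨hI.mul hinj hJ, hI.extIdeal hinj hproj hJ⟩,
    fun I J hI hJ => ⟨hI.mul hproj hJ, hI.extIdeal hinj hproj hJ⟩,
    ⟨fun I hI => hI.rightPerp hinj, fun I hI J hJ hIJ => ?_, fun K hK =>
      ⟨E.leftPerp K, hK.leftPerp hproj, hK.rightPerp_leftPerp⟩⟩,
    fun I J hI hJ => ⟨ExactStructure.rightPerp_mul hinj hI hJ,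
      ExactStructure.rightPerp_extIdeal hinj hproj hI hJ⟩⟩
  rw [← hI.leftPerp_rightPerp, ← hJ.leftPerp_rightPerp, hIJ]
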